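/- Let $X$ be a finite set of alternatives and let $X^*=\{x^F : x\in X\}\cup\{x^N : x\in X\}$ consist of a framed version $x^F$ and an unframed version $x^N$ of every alternative. Let $\mathcal{L}^*$ be the set of truncated strict preferences: rankings obtained from a strict linear order on $X^*$ that places $x^F$ above $x^N$ for every $x\in X$ by keeping only the ranking up to, and including, the best unframed alternative. Let $\Delta(\mathcal{L}^*)$ be the set of probability distributions on $\mathcal{L}^*$. For a recommendation $A\subseteq X$ put $A^*=\{x^F: x\in A\}\cup\{x^N : x\in X\setminus A\}$, and for $\mu\in\Delta(\mathcal{L}^*)$ and $x\in X$ let \[ \rho_\mu(x,A)=\sum_{\succ^*\in\mathcal{L}^*}\mu(\succ^*)\,\mathbb{1}_{\{\hat x\text{ is }\succ^*\text{-maximal in }A^*\}}, \] where $\hat x=x^F$ if $x\in A$ and $\hat x=x^N$ otherwise, and where alternatives not ranked by $\succ^*$ count as worse than all ranked ones. Call $\mu,\mu'$ observationally equivalent if $\rho_\mu(x,A)=\rho_{\mu'}(x,A)$ for all $x\in X$ and $A\subseteq X$. Two truncated preferences $\succ_1^*,\succ_2^*$, each ranking at least $k\ge 0$ elements, are $k$-compatible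 if their sets of $k$ best elements coincide; exchanging their initial segments of length $k$ then produces two further elements of $\mathcal{L}^*$. A Ryser swap is a signed measure in $\mathbb{R}^{\mathcal{L}^*}$ that, for some $k$, adds unit mass at each of two $k$-compatible truncated preferences and mass minus one at each of the two truncated preferences obtained by exchanging their initial segments of length $k$. Let $\mathcal{R}^{fd}\subseteq\mathbb{R}^{\mathcal{L}^*}$ be the linear span of the Ryser swaps. Then two distributions $\mu,\mu'\in\Delta(\mathcal{L}^*)$ are observationally equivalent if and only if $\mu-\mu'\in\mathcal{R}^{fd}$. In particular, for every $\mathcal{M}\subseteq\Delta(\mathcal{L}^*)$ and every $\mu\in\Delta(\mathcal{L}^*)$, the identified set $\{\nu\in\mathcal{M} : \rho_\nu=\rho_\mu\}$ equals $(\mu+\mathcal{R}^{fd})\cap\mathcal{M}$. -/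

import Mathlib

namespace FRUM

/-- The virtual alternatives: every alternative `x` in its framed version `x^F` and its unframed
version `x^N`, regarded as distinct objects. -/
inductive Alt (X : Type*) where
  | framed (x : X) : Alt X
  | unframed (x : X) : Alt X
  deriving DecidableEq

/-- Is a virtual alternative a framed one? -/
def Alt.isFramed {X : Type*} : Alt X → Bool
  | .framed _ => true
  | .unframed _ => false

/-- A truncated strict preference, written as its ranking from best to worst: a sequence of
distinct framed alternatives followed by one unframed alternative `x^N` (the best unframed one),
where `x^F` is ranked above `x^N`. -/
def IsTruncated {X : Type*} (l : List (Alt X)) : Prop :=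
  ∃ (s : List X) (x : X), l = s.map Alt.framed ++ [Alt.unframed x] ∧ s.Nodup ∧ x ∈ s

/-- The set of truncated strict preferences. -/
def TruncPref (X : Type*) : Type _ := {l : List (Alt X) // IsTruncated l}

/-- A full strict preference over the virtual alternatives in which framing makes each
alternative more desirable, written as its ranking from best to worst. -/
def IsFullPref {X : Type*} [DecidableEq X] (r : List (Alt X)) : Prop :=
  r.Nodup ∧ (∀ a, a ∈ r) ∧ ∀ x : X, r.idxOf (Alt.framed x) < r.idxOf (Alt.unframed x)

/-- The part of a ranking up to, and including, the best unframed alternative. -/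
def truncate {X : Type*} (r : List (Alt X)) : List (Alt X) :=
  r.takeWhile Alt.isFramed ++ (r.dropWhile Alt.isFramed).head?.toList

/-- The truncated preferences are exactly the truncations of full preferences. -/
theorem isTruncated_iff {X : Type*} [Fintype X] [Nonempty X] [DecidableEq X]
    (l : List (Alt X)) : IsTruncated l ↔ ∃ r, IsFullPref r ∧ truncate r = l := by
  have hF : Function.Injective (Alt.framed : X → Alt X) := fun a b h => by cases h; rfl
  have hN : Function.Injective (Alt.unframed : X → Alt X) := fun a b h => by cases h; rfl
  constructor
  · rintro ⟨s, x, rfl, hs, hx⟩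
    have htw : ∀ (u : List X) (v : List (Alt X)),
        truncate (u.map Alt.framed ++ Alt.unframed x :: v)
          = u.map Alt.framed ++ [Alt.unframed x] := by
      intro u v
      induction u with
      | nil => simp [truncate, Alt.isFramed]
      | cons a u ih => simpa [truncate, Alt.isFramed, List.takeWhile_cons, List.dropWhile_cons] using ih
    refine ⟨s.map Alt.framed ++ Alt.unframed x ::
      ((Finset.univ.toList.filter (fun y => y ∉ s)).map Alt.framed ++
        (Finset.univ.toList.filter (fun y => y ≠ x)).map Alt.unframed), ⟨?_, ?_, ?_⟩, htw _ _⟩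
    · have h1 : ((Finset.univ : Finset X).toList.filter (fun y => y ∉ s)).Nodup :=
        (Finset.nodup_toList _).filter _
      have h2 : ((Finset.univ : Finset X).toList.filter (fun y => y ≠ x)).Nodup :=
        (Finset.nodup_toList _).filter _
      rw [List.nodup_append]
      refine ⟨hs.map hF, ?_, ?_⟩
      · rw [List.nodup_cons, List.nodup_append]
        refine ⟨?_, h1.map hF, h2.map hN, ?_⟩
        · simp
        · simp
      · intro a ha b hb hab
        subst hab
        simp only [List.mem_map] at ha
        obtain ⟨y, hy, rfl⟩ := ha
        simp [hy] at hb
    · rintro (y | y)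
      · by_cases hy : y ∈ s <;> simp [hy]
      · by_cases hy : y = x <;> simp [hy]
    · intro y
      by_cases hy : y = x
      · subst hy
        rw [List.idxOf_append_of_mem (by simpa using hx),
          List.idxOf_append_of_notMem (by simp)]
        have := List.idxOf_lt_length_of_mem
          (show Alt.framed y ∈ s.map Alt.framed by simpa using hx)
        omega
      · rw [← List.cons_append, ← List.append_assoc]
        rw [List.idxOf_append_of_mem (a := Alt.framed y)
            (by by_cases h : y ∈ s <;> simp [h]),
          List.idxOf_append_of_notMem (a := Alt.unframed y) (by simp [hy])]
        exact lt_of_lt_of_le (List.idxOf_lt_length_of_mem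
          (by by_cases h : y ∈ s <;> simp [h])) (Nat.le_add_right _ _)
  · rintro ⟨r, ⟨hnd, hmem, hlt⟩, rfl⟩
    obtain ⟨x0⟩ := ‹Nonempty X›
    have key : ∀ r : List (Alt X), r.Nodup → Alt.unframed x0 ∈ r →
        ∃ (s : List X) (x : X) (v : List (Alt X)),
          r = s.map Alt.framed ++ Alt.unframed x :: v ∧
          truncate r = s.map Alt.framed ++ [Alt.unframed x] := by
      intro r
      induction r with
      | nil => intro _ h; simp at h
      | cons a r ih =>
        intro hn h
        cases a with
        | framed y =>
          obtain ⟨s, x, v, h1, h2⟩ := ih (List.nodup_cons.1 hn).2 (by simpa using h)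
          refine ⟨y :: s, x, v, by simp [h1], ?_⟩
          simpa [truncate, Alt.isFramed, List.takeWhile_cons, List.dropWhile_cons] using h2
        | unframed y => exact ⟨[], y, r, by simp, by simp [truncate, Alt.isFramed]⟩
    obtain ⟨s, x, v, h1, h2⟩ := key r hnd (hmem _)
    refine ⟨s, x, h2, ?_, ?_⟩
    · rw [h1] at hnd
      exact List.Nodup.of_map _ (List.nodup_append.1 hnd).1
    · by_contra hx
      have := hlt x
      rw [h1, List.idxOf_append_of_notMem (by simpa using hx),
        List.idxOf_append_of_notMem (by simp)] at this
      simp at this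

instance {X : Type*} [DecidableEq X] : DecidableEq (TruncPref X) :=
  inferInstanceAs (DecidableEq {l : List (Alt X) // IsTruncated l})

theorem TruncPref.nodup {X : Type*} (p : TruncPref X) : p.1.Nodup := by
  obtain ⟨l, s, x, rfl, hs, hx⟩ := p
  have : Function.Injective (Alt.framed : X → Alt X) := fun a b h => by cases h; rfl
  simp [List.nodup_append, hs.map this]

instance {X : Type*} [Fintype X] : Finite (TruncPref X) := by
  classical
  have e : Finite (Alt X) := Finite.of_surjective
    (fun p : X ⊕ X => Sum.elim Alt.framed Alt.unframed p) (by
      rintro (x | x)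
      · exact ⟨Sum.inl x, rfl⟩
      · exact ⟨Sum.inr x, rfl⟩)
  have := Fintype.ofFinite (Alt X)
  exact Finite.of_injective
    (fun p : TruncPref X => (⟨p.1, p.nodup⟩ : {l : List (Alt X) // l.Nodup}))
    (fun p q h => Subtype.ext (congrArg (fun z => z.1) h))

noncomputable instance {X : Type*} [Fintype X] : Fintype (TruncPref X) := Fintype.ofFinite _

/-- `a ≻* b`: `a` comes strictly before `b` in the ranking. An alternative that has been removed
by the truncation counts as ranked below all those that are kept (`List.idxOf` of a non-member is
the length of the list). -/
def TruncPref.Prefers {X : Type*} [DecidableEq X] (p : TruncPref X) (a b : Alt X) : Prop :=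
  p.1.idxOf a < p.1.idxOf b

/-- `a` is `≻*`-maximal in the menu `B`. -/
def TruncPref.IsMaximalIn {X : Type*} [DecidableEq X] (p : TruncPref X) (a : Alt X)
    (B : Set (Alt X)) : Prop :=
  a ∈ B ∧ a ∈ p.1 ∧ ∀ b ∈ B, b ≠ a → p.Prefers a b

/-- The version of `x` on offer when the set `A` is recommended: `x^F` if `x ∈ A`, else `x^N`. -/
def version {X : Type*} [DecidableEq X] (A : Finset X) (x : X) : Alt X :=
  if x ∈ A then Alt.framed x else Alt.unframed x

/-- The virtual menu `A^* = {x^N : x ∉ A} ∪ {x^F : x ∈ A}`. -/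
def virtualMenu {X : Type*} (A : Finset X) : Set (Alt X) :=
  {a | ∃ x, x ∉ A ∧ a = Alt.unframed x} ∪ {a | ∃ x, x ∈ A ∧ a = Alt.framed x}

open Classical in
/-- The frame-dependent choice data generated by a measure `μ` on truncated preferences: the
`μ`-mass of those for which the version of `x` on offer is maximal in the virtual menu. -/
noncomputable def choiceProb {X : Type*} [Fintype X] [DecidableEq X] (μ : TruncPref X → ℝ)
    (x : X) (A : Finset X) : ℝ :=
  ∑ p : TruncPref X, μ p * (if p.IsMaximalIn (version A x) (virtualMenu A) then 1 else 0)

/-- Two measures are observationally equivalent if they generate the same choice frequencies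
under every recommendation. -/
def ObsEquiv {X : Type*} [Fintype X] [DecidableEq X] (μ ν : TruncPref X → ℝ) : Prop :=
  ∀ (x : X) (A : Finset X), choiceProb μ x A = choiceProb ν x A

/-- The identified set of a restriction `M` given data `ρ`: all members of `M` generating `ρ`. -/
def identifiedSet {X : Type*} [Fintype X] [DecidableEq X] (M : Set (TruncPref X → ℝ))
    (ρ : X → Finset X → ℝ) : Set (TruncPref X → ℝ) :=
  {ν | ν ∈ M ∧ ∀ (x : X) (A : Finset X), choiceProb ν x A = ρ x A}

/-- `p` and `q` are `k`-compatible: both rank at least `k` alternatives and their sets of `k`-best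
alternatives coincide. -/
def Compatible {X : Type*} (k : ℕ) (p q : TruncPref X) : Prop :=
  k ≤ p.1.length ∧ k ≤ q.1.length ∧ ∀ a, a ∈ p.1.take k ↔ a ∈ q.1.take k

theorem Compatible.symm {X : Type*} {k : ℕ} {p q : TruncPref X} (h : Compatible k p q) :
    Compatible k q p :=
  ⟨h.2.1, h.1, fun a => (h.2.2 a).symm⟩

theorem Compatible.isTruncated {X : Type*} {k : ℕ} {p q : TruncPref X} (h : Compatible k p q) :
    IsTruncated (p.1.take k ++ q.1.drop k) := by
  obtain ⟨l, s, x, rfl, hs, hx⟩ := p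
  obtain ⟨m, t, y, rfl, ht, hy⟩ := q
  obtain ⟨h1, h2, h3⟩ := h
  simp only [List.length_append, List.length_map, List.length_singleton] at h1 h2 h3
  have full : ∀ (u : List X) (z : X), (u.map Alt.framed ++ [Alt.unframed z]).take (u.length + 1)
      = u.map Alt.framed ++ [Alt.unframed z] :=
    fun u z => List.take_of_length_le (by simp)
  have part : ∀ (u : List X) (z : X), k ≤ u.length →
      (u.map Alt.framed ++ [Alt.unframed z]).take k = (u.take k).map Alt.framed := by
    intro u z hk
    rw [List.take_append_of_le_length (by simpa using hk), List.map_take]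
  rcases Nat.lt_or_ge s.length k with hk | hk
  · have hk' : k = s.length + 1 := by omega
    rcases Nat.lt_or_ge t.length k with hl | hl
    · refine ⟨s, x, ?_, hs, hx⟩
      rw [List.drop_of_length_le (l := t.map Alt.framed ++ [Alt.unframed y])
        (by simp; omega), List.append_nil]
      exact List.take_of_length_le (by simp; omega)
    · have := (h3 (Alt.unframed x)).1 (by rw [hk', full]; simp)
      rw [part t y hl] at this
      simp [-List.map_take] at this
  · rcases Nat.lt_or_ge t.length k with hl | hl
    · have hk' : k = t.length + 1 := by omega
      have := (h3 (Alt.unframed y)).2 (by rw [hk', full]; simp)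
      rw [part s x hk] at this
      simp [-List.map_take] at this
    · rw [part s x hk, part t y hl] at h3
      have hset : ∀ a, a ∈ s.take k ↔ a ∈ t.take k := fun a => by
        simpa [-List.map_take] using h3 (Alt.framed a)
      refine ⟨s.take k ++ t.drop k, y, ?_, ?_, ?_⟩
      · show List.take k _ ++ List.drop k _ = _
        rw [part s x hk, List.drop_append_of_le_length (by simpa using hl), List.map_append,
          List.map_drop, List.append_assoc]
      · have htd : (t.take k ++ t.drop k).Nodup := by rwa [List.take_append_drop]
        rw [List.nodup_append] at htd ⊢
        exact ⟨hs.sublist (List.take_sublist _ _), htd.2.1,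
          fun a ha b hb => htd.2.2 a ((hset a).1 ha) b hb⟩
      · rw [← List.take_append_drop k t, List.mem_append] at hy
        rw [List.mem_append, hset]
        exact hy

/-- The `k`-initial segment of `p` followed by what `q` ranks below its `k` best alternatives; for
`k`-compatible `p` and `q` this is again a truncated preference. -/
def splice {X : Type*} (k : ℕ) (p q : TruncPref X) (h : Compatible k p q) : TruncPref X :=
  ⟨p.1.take k ++ q.1.drop k, h.isTruncated⟩

/-- A Ryser swap: unit mass on each of two `k`-compatible truncated preferences, and mass minus
one on each of the two obtained from them by swapping their `k`-initial segments. -/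
def IsRyserSwap {X : Type*} [DecidableEq X] (R : TruncPref X → ℝ) : Prop :=
  ∃ (k : ℕ) (p q : TruncPref X) (h : Compatible k p q),
    R = (Pi.single p 1 + Pi.single q 1)
      - (Pi.single (splice k p q h) 1 + Pi.single (splice k q p h.symm) 1)

/-- The linear span of the Ryser swaps. -/
def ryserSpace (X : Type*) [DecidableEq X] : Submodule ℝ (TruncPref X → ℝ) :=
  Submodule.span ℝ {R | IsRyserSwap R}

end FRUM

namespace FRUM

section

/-! A swap preserves choice data: whether `a` is best in a menu depends only on the top `k` block if
`a` lies in it, and otherwise only on that block as a set and on the tail (`maxIn_splice_add`).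

Conversely, if all choice frequencies of `ν` vanish, Möbius inversion over recommendations shows
that `flow ν S a`, the mass ranking `a` immediately below the set `S`, vanishes for all `S` and `a`
(`flow_eq_zero`). Modulo swaps, a ranking is the sum of a fixed class and of one term `stepClass S
a` per entry: close each initial segment by a tail depending only on its set and telescope
(`TruncPref.mkQ_single`). Hence the class of `ν` is its total mass times the fixed class plus the
sum of `flow ν S a • stepClass S a`, which is zero. -/

theorem Alt.framed_injective {X : Type*} : Function.Injective (Alt.framed : X → Alt X) :=
  fun a b h => by cases h; rfl

variable {X : Type*} [DecidableEq X]

/-! ### Invariance of choice data under swaps -/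

/-- The property of being maximal in the menu `B`, for an arbitrary ranking. -/
def MaxIn (l : List (Alt X)) (a : Alt X) (B : Set (Alt X)) : Prop :=
  a ∈ B ∧ a ∈ l ∧ ∀ b ∈ B, b ≠ a → l.idxOf a < l.idxOf b

theorem maxIn_append_of_mem {u v v' : List (Alt X)} {a : Alt X} (B : Set (Alt X)) (ha : a ∈ u) :
    MaxIn (u ++ v) a B ↔ MaxIn (u ++ v') a B := by
  have h : ∀ w : List (Alt X), ∀ b,
      ((u ++ w).idxOf a < (u ++ w).idxOf b ↔ u.idxOf a < u.idxOf b) := by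
    intro w b
    have h1 := List.idxOf_lt_length_of_mem ha
    rw [List.idxOf_append_of_mem ha]
    by_cases hb : b ∈ u
    · rw [List.idxOf_append_of_mem hb]
    · rw [List.idxOf_append_of_notMem hb, List.idxOf_eq_length hb]
      omega
  simp only [MaxIn, h, List.mem_append, ha, true_or]

/-- Every element of the initial block beats `a`, in whatever order the block is listed. -/
theorem maxIn_append_of_notMem {u u' v : List (Alt X)} {a : Alt X} (B : Set (Alt X))
    (hu : ∀ b, b ∈ u ↔ b ∈ u') (ha : a ∉ u) :
    MaxIn (u ++ v) a B ↔ MaxIn (u' ++ v) a B := by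
  have h : ∀ w : List (Alt X), a ∉ w → ∀ b,
      ((w ++ v).idxOf a < (w ++ v).idxOf b ↔ b ∉ w ∧ v.idxOf a < v.idxOf b) := by
    intro w hw b
    rw [List.idxOf_append_of_notMem hw]
    by_cases hb : b ∈ w
    · have h1 := List.idxOf_lt_length_of_mem hb
      rw [List.idxOf_append_of_mem hb]
      simp only [hb, not_true_eq_false, false_and, iff_false]
      omega
    · rw [List.idxOf_append_of_notMem hb]
      simp [hb]
  have ha' : a ∉ u' := fun h' => ha ((hu a).2 h')
  simp only [MaxIn, h u ha, h u' ha', List.mem_append, ha, ha', hu]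

-- If `a` is in the common top block, each splice agrees with the ranking sharing its head;
-- otherwise, with the one sharing its tail.
open Classical in
theorem maxIn_splice_add {k : ℕ} {p q : TruncPref X} (h : Compatible k p q) (a : Alt X)
    (B : Set (Alt X)) :
    (if p.IsMaximalIn a B then (1 : ℝ) else 0) + (if q.IsMaximalIn a B then 1 else 0)
      = (if (splice k p q h).IsMaximalIn a B then 1 else 0)
        + (if (splice k q p h.symm).IsMaximalIn a B then 1 else 0) := by
  have e1 : (splice k p q h).IsMaximalIn a B ↔ MaxIn (p.1.take k ++ q.1.drop k) a B := Iff.rfl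
  have e2 : (splice k q p h.symm).IsMaximalIn a B ↔ MaxIn (q.1.take k ++ p.1.drop k) a B :=
    Iff.rfl
  have e3 : ∀ p : TruncPref X,
      p.IsMaximalIn a B ↔ MaxIn (p.1.take k ++ p.1.drop k) a B := fun p => by
    rw [List.take_append_drop]; exact Iff.rfl
  rw [e1, e2, e3 p, e3 q]
  by_cases ha : a ∈ p.1.take k
  · rw [maxIn_append_of_mem (v' := q.1.drop k) B ha,
      maxIn_append_of_mem (v' := p.1.drop k) B ((h.2.2 a).1 ha)]
  · rw [maxIn_append_of_notMem (v := p.1.drop k) B h.2.2 ha,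
      ← maxIn_append_of_notMem (v := q.1.drop k) B h.2.2 ha, add_comm]

theorem choiceProb_sub [Fintype X] (μ ν : TruncPref X → ℝ) (x : X) (A : Finset X) :
    choiceProb (μ - ν) x A = choiceProb μ x A - choiceProb ν x A := by
  simp only [choiceProb, Pi.sub_apply, sub_mul, Finset.sum_sub_distrib]

theorem choiceProb_eq_zero_of_mem_ryserSpace [Fintype X] {R : TruncPref X → ℝ}
    (hR : R ∈ ryserSpace X) (x : X) (A : Finset X) : choiceProb R x A = 0 := by
  induction hR using Submodule.span_induction with
  | mem R h =>
    obtain ⟨k, p, q, h, rfl⟩ := h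
    have := maxIn_splice_add h (version A x) (virtualMenu A)
    simp only [choiceProb, Pi.sub_apply, Pi.add_apply, sub_mul, add_mul, Finset.sum_sub_distrib,
      Finset.sum_add_distrib, Pi.single_apply, ite_mul, one_mul, zero_mul, Finset.sum_ite_eq',
      Finset.mem_univ, if_true]
    linarith
  | zero => simp [choiceProb]
  | add f g _ _ hf hg =>
    simp only [choiceProb, Pi.add_apply, add_mul, Finset.sum_add_distrib] at hf hg ⊢
    rw [hf, hg, add_zero]
  | smul c f _ hf =>
    simp only [choiceProb, Pi.smul_apply, smul_eq_mul, mul_assoc, ← Finset.mul_sum] at hf ⊢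
    rw [hf, mul_zero]

/-! ### Möbius inversion: choice data determine flows -/

/-- The alternatives whose framed version is ranked strictly above `a`. -/
def above [Fintype X] (l : List (Alt X)) (a : Alt X) : Finset X :=
  Finset.univ.filter fun y => l.idxOf (Alt.framed y) < l.idxOf a

theorem TruncPref.idxOf_lt_unframed (p : TruncPref X) {a : Alt X} (ha : a ∈ p.1) {y : X}
    (hy : Alt.unframed y ≠ a) : p.1.idxOf a < p.1.idxOf (Alt.unframed y) := by
  obtain ⟨l, s, x, rfl, hs, hx⟩ := p
  dsimp only at ha ⊢
  rw [List.idxOf_append_of_notMem (a := Alt.unframed y) (by simp)]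
  rcases List.mem_append.1 ha with h | h
  · rw [List.idxOf_append_of_mem h]
    have := List.idxOf_lt_length_of_mem h
    omega
  · obtain rfl := List.mem_singleton.1 h
    rw [List.idxOf_append_of_notMem (by simp)]
    simp [hy.symm]

/-- Only framed competitors matter: the one unframed entry comes last, and all other unframed
alternatives are unranked. -/
theorem isMaximalIn_version_iff [Fintype X] (p : TruncPref X) (x : X) (A : Finset X) :
    p.IsMaximalIn (version A x) (virtualMenu A) ↔
      version A x ∈ p.1 ∧ above p.1 (version A x) ⊆ Aᶜ := by
  have hmem : version A x ∈ virtualMenu A := by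
    unfold version virtualMenu
    split_ifs with h <;> simp [h]
  unfold TruncPref.IsMaximalIn TruncPref.Prefers
  generalize version A x = a at *
  refine ⟨fun ⟨_, h1, h2⟩ => ⟨h1, fun y hy => ?_⟩, fun ⟨h1, h2⟩ => ⟨hmem, h1, ?_⟩⟩
  · rw [Finset.mem_compl]
    intro hyA
    simp only [above, Finset.mem_filter, Finset.mem_univ, true_and] at hy
    have := h2 (Alt.framed y) (Or.inr ⟨y, hyA, rfl⟩) (by rintro rfl; exact lt_irrefl _ hy)
    omega
  · rintro b (⟨y, hy, rfl⟩ | ⟨y, hy, rfl⟩) hb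
    · exact p.idxOf_lt_unframed h1 hb
    · by_contra hlt
      rcases (not_lt.1 hlt).lt_or_eq with h | h
      · have := h2 (show y ∈ above p.1 a by simpa [above] using h)
        exact (Finset.mem_compl.1 this) hy
      · have hy' : Alt.framed y ∈ p.1 :=
          List.idxOf_lt_length_iff.1 (h ▸ List.idxOf_lt_length_of_mem h1)
        exact hb ((List.idxOf_inj hy').1 h)

theorem TruncPref.mem_above_unframed [Fintype X] (p : TruncPref X) {x : X}
    (hx : Alt.unframed x ∈ p.1) : x ∈ above p.1 (Alt.unframed x) := by
  have hF : Alt.framed x ∈ p.1 := by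
    obtain ⟨l, s, z, rfl, hs, hz⟩ := p
    simp only [List.mem_append, List.mem_map, List.mem_singleton] at hx
    simp at hx
    simp [hx, hz]
  simpa [above] using p.idxOf_lt_unframed hF (y := x) (by simp)

open Classical in
/-- The mass of the truncated preferences that rank `a` immediately below the set `S` of framed
alternatives. -/
noncomputable def flow [Fintype X] (ν : TruncPref X → ℝ) (S : Finset X) (a : Alt X) : ℝ :=
  ∑ p : TruncPref X, if a ∈ p.1 ∧ above p.1 a = S then ν p else 0

theorem sum_flow_powerset [Fintype X] (ν : TruncPref X → ℝ) (x : X) (A : Finset X) :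
    ∑ S ∈ Aᶜ.powerset, flow ν S (version A x) = choiceProb ν x A := by
  unfold flow choiceProb
  rw [Finset.sum_comm]
  refine Finset.sum_congr rfl fun p _ => ?_
  simp only [isMaximalIn_version_iff]
  by_cases h : version A x ∈ p.1 <;> simp [h]

/-- Recommending `Sᶜ` sums the flows over all subsets of `S`; by induction only the term at `S`
remains. The pairs not reached this way carry no mass: `x^F` is not above itself, and `x^F` is
always above a ranked `x^N`. -/
theorem flow_eq_zero [Fintype X] {ν : TruncPref X → ℝ}
    (h : ∀ x A, choiceProb ν x A = 0) (a : Alt X) (S : Finset X) : flow ν S a = 0 := by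
  induction S using Finset.strongInduction with
  | H S ih =>
  have key : ∀ x, version Sᶜ x = a → flow ν S a = 0 := by
    intro x hx
    have h1 := sum_flow_powerset ν x Sᶜ
    rw [h, hx, compl_compl, ← Finset.insert_erase (Finset.mem_powerset_self S),
      Finset.sum_insert (Finset.notMem_erase _ _), Finset.sum_eq_zero, add_zero] at h1
    · exact h1
    · intro T hT
      rw [Finset.mem_erase, Finset.mem_powerset] at hT
      exact ih T (hT.2.ssubset_of_ne hT.1)
  rcases a with x | x
  · by_cases hx : x ∈ S
    · refine Finset.sum_eq_zero fun p _ => if_neg ?_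
      rintro ⟨-, rfl⟩
      simp [above] at hx
    · exact key x (by simp [version, hx])
  · by_cases hx : x ∈ S
    · exact key x (by simp [version, hx])
    · refine Finset.sum_eq_zero fun p _ => if_neg ?_
      rintro ⟨hp, rfl⟩
      exact hx (p.mem_above_unframed hp)

/-! ### Telescoping rankings modulo swaps -/

open Classical in
/-- The class of a ranking modulo the Ryser swaps (zero if it is not a truncated preference). -/
noncomputable def swapClass (l : List (Alt X)) : (TruncPref X → ℝ) ⧸ ryserSpace X :=
  if h : IsTruncated l then (ryserSpace X).mkQ (Pi.single ⟨l, h⟩ 1) else 0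

theorem swapClass_add_swapClass {s t : List X} {b c : List (Alt X)} (hs : s.Nodup)
    (ht : t.Nodup) (hst : s.toFinset = t.toFinset) (hb : IsTruncated (s.map Alt.framed ++ b))
    (hc : IsTruncated (t.map Alt.framed ++ c)) :
    swapClass (s.map Alt.framed ++ b) + swapClass (t.map Alt.framed ++ c)
      = swapClass (s.map Alt.framed ++ c) + swapClass (t.map Alt.framed ++ b) := by
  have hlen : s.length = t.length := by
    rw [← List.toFinset_card_of_nodup hs, ← List.toFinset_card_of_nodup ht, hst]
  have hmem : ∀ y, y ∈ s ↔ y ∈ t := fun y => by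
    rw [← List.mem_toFinset, hst, List.mem_toFinset]
  have ts : ∀ b : List (Alt X), (s.map Alt.framed ++ b).take s.length = s.map Alt.framed :=
    fun b => List.take_left' (by simp)
  have tt : ∀ b : List (Alt X), (t.map Alt.framed ++ b).take s.length = t.map Alt.framed :=
    fun b => List.take_left' (by simp [hlen])
  have ds : ∀ b : List (Alt X), (s.map Alt.framed ++ b).drop s.length = b :=
    fun b => List.drop_left' (by simp)
  have dt : ∀ b : List (Alt X), (t.map Alt.framed ++ b).drop s.length = b :=
    fun b => List.drop_left' (by simp [hlen])
  have hcomp : Compatible s.length (⟨_, hb⟩ : TruncPref X) ⟨_, hc⟩ := by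
    refine ⟨by simp, by simp [hlen], fun a => ?_⟩
    dsimp only
    rw [ts, tt]
    simp [hmem]
  have h1 := hcomp.isTruncated
  have h2 := hcomp.symm.isTruncated
  have e1 : splice _ _ _ hcomp = ⟨s.map Alt.framed ++ c, by simpa only [ts, dt] using h1⟩ :=
    Subtype.ext (by simp only [splice, ts, dt])
  have e2 : splice _ _ _ hcomp.symm = ⟨t.map Alt.framed ++ b, by simpa only [tt, ds] using h2⟩ :=
    Subtype.ext (by simp only [splice, tt, ds])
  simp only [ts, dt, tt, ds] at h1 h2
  simp only [swapClass, hb, hc, h1, h2, dif_pos, ← map_add]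
  rw [← sub_eq_zero, ← map_sub, Submodule.mkQ_apply, Submodule.Quotient.mk_eq_zero]
  refine Submodule.subset_span ⟨_, _, _, hcomp, ?_⟩
  rw [e1, e2]

variable [Nonempty X]

open Classical in
/-- A completion to a truncated preference, depending only on the set of framed alternatives
ranked so far. -/
noncomputable def completion (S : Finset X) : List (Alt X) :=
  -- An unframed entry needs its framed version above it, so the empty set requires a framed
  -- alternative first.
  if h : S.Nonempty then [Alt.unframed h.choose]
  else [Alt.framed (Classical.arbitrary X), Alt.unframed (Classical.arbitrary X)]

theorem isTruncated_append_completion {s : List X} (hs : s.Nodup) :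
    IsTruncated (s.map Alt.framed ++ completion s.toFinset) := by
  unfold completion
  split_ifs with h
  · exact ⟨s, h.choose, rfl, hs, List.mem_toFinset.1 h.choose_spec⟩
  · obtain rfl : s = [] := by simpa using h
    exact ⟨[Classical.arbitrary X], Classical.arbitrary X, by simp, by simp, by simp⟩

/-- The completion after ranking `a` immediately below `S`. -/
noncomputable def completionThrough (S : Finset X) : Alt X → List (Alt X)
  | .framed x => Alt.framed x :: completion (insert x S)
  | .unframed x => [Alt.unframed x]

/-- The contribution of ranking `a` immediately below `S` to the class of a ranking. -/
noncomputable def stepClass (S : Finset X) (a : Alt X) : (TruncPref X → ℝ) ⧸ ryserSpace X :=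
  swapClass (S.toList.map Alt.framed ++ completionThrough S a)
    - swapClass (S.toList.map Alt.framed ++ completion S)

/-- Exchanging heads with the reference order `S.toList` shows that the increment depends on the set
ranked so far, not on its order. -/
theorem swapClass_completionThrough {s : List X} (hs : s.Nodup) {a : Alt X}
    (ha : IsTruncated (s.map Alt.framed ++ completionThrough s.toFinset a)) :
    swapClass (s.map Alt.framed ++ completionThrough s.toFinset a)
      = swapClass (s.map Alt.framed ++ completion s.toFinset) + stepClass s.toFinset a := by
  have hc := isTruncated_append_completion (Finset.nodup_toList s.toFinset)
  rw [Finset.toList_toFinset] at hc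
  have := swapClass_add_swapClass hs (Finset.nodup_toList s.toFinset)
    (Finset.toList_toFinset _).symm ha hc
  rw [stepClass, ← add_sub_assoc, ← this, add_sub_cancel_right]

omit [Nonempty X] in
theorem sum_above_append_singleton [Fintype X] {E : Type*} [AddCommGroup E]
    (f : Finset X → Alt X → E) (s : List X) {b : Alt X} (hb : b ∉ s.map Alt.framed) :
    ∑ a ∈ (s.map Alt.framed ++ [b]).toFinset, f (above (s.map Alt.framed ++ [b]) a) a
      = ∑ a ∈ (s.map Alt.framed).toFinset, f (above (s.map Alt.framed) a) a
        + f s.toFinset b := by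
  have h1 : (s.map Alt.framed ++ [b]).toFinset = insert b (s.map Alt.framed).toFinset := by
    ext a; simp
  rw [h1, Finset.sum_insert (by simpa using hb), add_comm]
  congr 1
  · refine Finset.sum_congr rfl fun a ha => ?_
    rw [List.mem_toFinset] at ha
    congr 1
    ext y
    simp only [above, Finset.mem_filter, Finset.mem_univ, true_and]
    have := List.idxOf_lt_length_of_mem ha
    rw [List.idxOf_append_of_mem ha]
    by_cases hy : Alt.framed y ∈ s.map Alt.framed
    · rw [List.idxOf_append_of_mem hy]
    · rw [List.idxOf_append_of_notMem hy, List.idxOf_eq_length hy]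
      omega
  · congr 1
    ext y
    simp only [above, Finset.mem_filter, Finset.mem_univ, true_and, List.mem_toFinset]
    rw [List.idxOf_append_of_notMem hb]
    by_cases hy : Alt.framed y ∈ s.map Alt.framed
    · have := List.idxOf_lt_length_of_mem hy
      rw [List.idxOf_append_of_mem hy]
      simp only [List.mem_map_of_injective Alt.framed_injective] at hy
      simp only [hy, iff_true]
      omega
    · rw [List.idxOf_append_of_notMem hy]
      simp only [List.mem_map_of_injective Alt.framed_injective] at hy
      simp [hy]

theorem swapClass_append_completion [Fintype X] {s : List X} (hs : s.Nodup) :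
    swapClass (s.map Alt.framed ++ completion s.toFinset)
      = swapClass (completion (∅ : Finset X))
        + ∑ a ∈ (s.map Alt.framed).toFinset, stepClass (above (s.map Alt.framed) a) a := by
  induction s using List.reverseRecOn with
  | nil => simp
  | append_singleton s x ih =>
    have hs' : s.Nodup := hs.sublist (List.sublist_append_left _ _)
    have hx : x ∉ s := fun h => by
      rw [List.nodup_append] at hs
      exact hs.2.2 x h x (by simp) rfl
    have e : (s ++ [x]).map Alt.framed ++ completion (s ++ [x]).toFinset
        = s.map Alt.framed ++ completionThrough s.toFinset (Alt.framed x) := by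
      have : (s ++ [x]).toFinset = insert x s.toFinset := by ext y; simp
      simp [this, completionThrough]
    have ht := isTruncated_append_completion hs
    rw [e] at ht ⊢
    rw [swapClass_completionThrough hs' ht, ih hs', List.map_append, List.map_singleton,
      sum_above_append_singleton _ _ (by simpa using hx), add_assoc]

/-- The final unframed entry is its own completion, so the telescoping sum ends exactly at `p`. -/
theorem TruncPref.mkQ_single [Fintype X] (p : TruncPref X) :
    (ryserSpace X).mkQ (Pi.single p 1)
      = swapClass (completion (∅ : Finset X)) + ∑ a ∈ p.1.toFinset, stepClass (above p.1 a) a := by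
  have h0 : (ryserSpace X).mkQ (Pi.single p 1) = swapClass p.1 := by
    rw [swapClass, dif_pos p.2]
    rfl
  rw [h0]
  obtain ⟨l, s, x, rfl, hs, hx⟩ := p
  dsimp only
  rw [sum_above_append_singleton _ _ (by simp), ← add_assoc, ← swapClass_append_completion hs]
  exact swapClass_completionThrough hs (a := Alt.unframed x) ⟨s, x, rfl, hs, hx⟩

instance [Fintype X] : Finite (Alt X) :=
  Finite.of_surjective (Sum.elim Alt.framed Alt.unframed) (by
    rintro (x | x)
    · exact ⟨Sum.inl x, rfl⟩
    · exact ⟨Sum.inr x, rfl⟩)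

end

/-! ### Conclusion -/

theorem mem_ryserSpace_of_choiceProb_eq_zero {X : Type*} [Fintype X] [DecidableEq X]
    {ν : TruncPref X → ℝ} (hsum : ∑ p, ν p = 0) (h : ∀ x A, choiceProb ν x A = 0) :
    ν ∈ ryserSpace X := by
  classical
  rcases isEmpty_or_nonempty X with hX | hX
  · have : IsEmpty (TruncPref X) := ⟨fun ⟨_, _, x, _⟩ => hX.elim x⟩
    rw [Subsingleton.elim ν 0]
    exact zero_mem _
  have := Fintype.ofFinite (Alt X)
  rw [← Submodule.Quotient.mk_eq_zero, ← Submodule.mkQ_apply]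
  have hν : ν = ∑ p, ν p • (Pi.single p 1 : TruncPref X → ℝ) := by
    ext q
    simp [Finset.sum_apply, Pi.single_apply]
  have hexp : ∀ p : TruncPref X, ∑ a ∈ p.1.toFinset, stepClass (above p.1 a) a
      = ∑ a, ∑ S, if a ∈ p.1 ∧ above p.1 a = S then stepClass S a else 0 := by
    intro p
    simp only [ite_and, Finset.sum_ite_irrel, Finset.sum_ite_eq, Finset.mem_univ, if_true,
      Finset.sum_const_zero]
    rw [← Finset.sum_filter]
    congr 1
    ext a
    simp
  rw [hν, map_sum]
  simp only [map_smul, TruncPref.mkQ_single, smul_add, Finset.sum_add_distrib, ← Finset.sum_smul,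
    hsum, zero_smul, zero_add, hexp, Finset.smul_sum]
  -- Summing over rankings innermost makes the coefficient of `stepClass S a` the flow of `ν` at
  -- that pair.
  rw [Finset.sum_comm]
  refine Finset.sum_eq_zero fun a _ => ?_
  rw [Finset.sum_comm]
  refine Finset.sum_eq_zero fun S _ => ?_
  have hf := flow_eq_zero h a S
  unfold flow at hf
  calc ∑ p, ν p • (if a ∈ p.1 ∧ above p.1 a = S then stepClass S a else 0)
      = (∑ p : TruncPref X, if a ∈ p.1 ∧ above p.1 a = S then ν p else 0) • stepClass S a := by
        simp only [Finset.sum_smul, smul_ite, ite_smul, smul_zero, zero_smul]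
    _ = 0 := by rw [hf, zero_smul]

theorem obsEquiv_iff_sub_mem {X : Type*} [Fintype X] [DecidableEq X] {μ ν : TruncPref X → ℝ}
    (hμ : μ ∈ stdSimplex ℝ (TruncPref X)) (hν : ν ∈ stdSimplex ℝ (TruncPref X)) :
    ObsEquiv μ ν ↔ μ - ν ∈ ryserSpace X := by
  constructor
  · intro h
    refine mem_ryserSpace_of_choiceProb_eq_zero ?_ fun x A => ?_
    · simp only [Pi.sub_apply, Finset.sum_sub_distrib, hμ.2, hν.2, sub_self]
    · rw [choiceProb_sub, h x A, sub_self]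
  · intro h x A
    have := choiceProb_eq_zero_of_mem_ryserSpace h x A
    rwa [choiceProb_sub, sub_eq_zero] at this

end FRUM

theorem theorem6 {X : Type*} [Fintype X] [DecidableEq X] :
    (∀ μ ∈ stdSimplex ℝ (FRUM.TruncPref X), ∀ μ' ∈ stdSimplex ℝ (FRUM.TruncPref X),
      FRUM.ObsEquiv μ μ' ↔ μ - μ' ∈ FRUM.ryserSpace X) ∧
    (∀ M ⊆ stdSimplex ℝ (FRUM.TruncPref X), ∀ μ ∈ stdSimplex ℝ (FRUM.TruncPref X),
      FRUM.identifiedSet M (FRUM.choiceProb μ)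
        = {ν | ∃ R ∈ FRUM.ryserSpace X, ν = μ + R} ∩ M) := by
  refine ⟨fun μ hμ μ' hμ' => FRUM.obsEquiv_iff_sub_mem hμ hμ', fun M hM μ hμ => ?_⟩
  ext ν
  constructor
  · rintro ⟨hν, h⟩
    exact ⟨⟨ν - μ, (FRUM.obsEquiv_iff_sub_mem (hM hν) hμ).1 h, by abel⟩, hν⟩
  · rintro ⟨⟨R, hR, rfl⟩, hν⟩
    exact ⟨hν, (FRUM.obsEquiv_iff_sub_mem (hM hν) hμ).2 (by simpa using hR)⟩
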